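/- For a (simple) graph $G$ and a positive integer $i$, an $i$-packing in $G$ is a set $W\subseteq V(G)$ such that any two distinct vertices of $W$ are at distance greater than $i$ in $G$. For a sequence $(s_1,\dots,s_m)$ of positive integers, $G$ is $(s_1,\dots,s_m)$-colorable if $V(G)$ can be partitioned into (possibly empty) sets $\Pi_1,\dots,\Pi_m$ such that $\Pi_j$ is an $s_j$-packing for each $j$. The packing chromatic number $\chi_\rho(G)$ is the smallest $m$ such that $G$ is $(1,2,\dots,m)$-colorable. The subdivision $S(G)$ is the graph obtained from $G$ by replacing each edge with a path of length $2$ through a new vertex. For positive integers $n,k$ with $k<n/2$, the generalized Petersen graph $P(n,k)$ has vertex set $\{u_1,\dots,u_n,v_1,\dots,v_n\}$ and edges $u_iu_{i+1}$, $u_iv_i$, $v_iv_{i+k}$ for $1\le i\le n$, with subscripts taken modulo $n$. Corollary 4.2. If $n$ and $k$ are positive integers such that $k<n/2$ and $n$ is not a multiple of $5$, then $P(n,k)$ is $(1,1,2,2)$-colorable, and hence $\chi_\rho(S(P(n,k)))\le 5$. -/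

import Mathlib

namespace PackingColoring

/-- `W` is an `i`-packing of `G`: any two distinct vertices of `W` are at distance greater than `i`
(vertices in different components are at infinite distance). -/
def IsPacking {V : Type*} (G : SimpleGraph V) (i : ℕ) (W : Set V) : Prop :=
  ∀ ⦃u⦄, u ∈ W → ∀ ⦃v⦄, v ∈ W → u ≠ v → (i : ℕ∞) < G.edist u v

/-- `G` is `(s₁, …, s_k)`-colorable: the vertex set splits into `k` (possibly empty) classes,
the `j`-th of which is an `s_j`-packing. -/
def SColorable {V : Type*} (G : SimpleGraph V) {k : ℕ} (s : Fin k → ℕ) : Prop :=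
  ∃ c : V → Fin k, ∀ j : Fin k, IsPacking G (s j) {v | c v = j}

/-- `G` has a `k`-packing coloring, that is, a `(1, 2, …, k)`-coloring. -/
def PackingColorable {V : Type*} (G : SimpleGraph V) (k : ℕ) : Prop :=
  SColorable G (fun j : Fin k => (j : ℕ) + 1)

/-- The packing chromatic number: the least `k` such that `G` has a `k`-packing coloring
(`⊤` if there is no such `k`). -/
noncomputable def packingChromaticNumber {V : Type*} (G : SimpleGraph V) : ℕ∞ :=
  ⨅ (k : ℕ) (_ : PackingColorable G k), (k : ℕ∞)

/-- The subdivision `S(G)`: every edge `e` of `G` is replaced by a path of length two through a new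
vertex `Sum.inr e`. -/
def subdivision {V : Type*} (G : SimpleGraph V) : SimpleGraph (V ⊕ G.edgeSet) where
  Adj x y :=
    (∃ (v : V) (e : G.edgeSet), v ∈ (e : Sym2 V) ∧ x = Sum.inl v ∧ y = Sum.inr e) ∨
    (∃ (v : V) (e : G.edgeSet), v ∈ (e : Sym2 V) ∧ y = Sum.inl v ∧ x = Sum.inr e)
  symm := ⟨fun _ _ h => h.symm⟩
  loopless := ⟨by
    rintro x (⟨v, e, -, rfl, h⟩ | ⟨v, e, -, rfl, h⟩) <;> simp at h⟩

/-- The generalized Petersen graph `P(n, k)` (of interest for `0 < k < n / 2`):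
`Sum.inl i` is the outer vertex `u_i`, `Sum.inr i` is the inner vertex `v_i`, and the edges are
`u_i u_{i+1}`, `u_i v_i` and `v_i v_{i+k}`, with indices modulo `n`. -/
def generalizedPetersen (n k : ℕ) : SimpleGraph (ZMod n ⊕ ZMod n) :=
  SimpleGraph.fromEdgeSet
    ({e | ∃ i : ZMod n, e = s(Sum.inl i, Sum.inl (i + 1))} ∪
      {e | ∃ i : ZMod n, e = s(Sum.inl i, Sum.inr i)} ∪
      {e | ∃ i : ZMod n, e = s(Sum.inr i, Sum.inr (i + (k : ZMod n)))})

end PackingColoring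

namespace PackingColoring

/-! ### Packings, and passing from `G` to its subdivision -/

section General

variable {V : Type*} {G : SimpleGraph V}

/-! Subdividing doubles distances, so the classes of a (1,1,2,2)-colouring become 3-, 3-, 5-,
5-packings of `S(G)`. These serve as colours 2, 3, 4, 5, and the new vertices take colour 1.

For `P(n, k)` with colours `0, 1, 2, 3`, the outer cycle alternates `0`, `1` (for odd `n`, `u₀` gets
`2`). By default `v_i` takes the parity colour opposite to that of `i`; colours `2` and `3` are
placed where this default would clash along inner edges.

For even `n` each inner cycle follows a pattern that exists for every length at least 3 except 5.
For odd `n` there are explicit formulas, split by the parity of `k` and by whether `3 * k ≤ n`; only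
one of them needs `5 ∤ n`, to exclude `5 * k = 2 * n`. -/

theorem exists_walk_of_edist_le {u v : V} {m : ℕ} (h : G.edist u v ≤ m) :
    ∃ p : G.Walk u v, p.length ≤ m := by
  obtain ⟨p, hp⟩ := SimpleGraph.exists_walk_of_edist_ne_top
    (ne_top_of_le_ne_top (ENat.natCast_ne_top m) h)
  exact ⟨p, by rw [← hp] at h; exact_mod_cast h⟩

theorem one_lt_edist {u v : V} (hne : u ≠ v) (hadj : ¬ G.Adj u v) :
    ((1 : ℕ) : ℕ∞) < G.edist u v := by
  by_contra h
  obtain ⟨p, hp⟩ := exists_walk_of_edist_le (not_lt.mp h)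
  match p, hp with
  | .nil, _ => exact hne rfl
  | .cons h1 .nil, _ => exact hadj h1
  | .cons _ (.cons _ p), hp => simp at hp

theorem two_lt_edist {u v : V} (hne : u ≠ v) (hadj : ¬ G.Adj u v)
    (hcommon : ∀ w, G.Adj u w → ¬ G.Adj w v) : ((2 : ℕ) : ℕ∞) < G.edist u v := by
  by_contra h
  obtain ⟨p, hp⟩ := exists_walk_of_edist_le (not_lt.mp h)
  match p, hp with
  | .nil, _ => exact hne rfl
  | .cons h1 .nil, _ => exact hadj h1
  | .cons h1 (.cons h2 .nil), _ => exact hcommon _ h1 h2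
  | .cons _ (.cons _ (.cons _ p)), hp => simp at hp

/-- A proper colouring with the colours `0, 1, 2, 3` in which the colours `2` and `3` do not repeat
at distance two is a `(1, 1, 2, 2)`-colouring. -/
theorem sColorable_of_coloring (c : V → ℕ) (hc : ∀ v, c v < 4)
    (hadj : ∀ u v, G.Adj u v → c u ≠ c v)
    (htwo : ∀ u w v, G.Adj u w → G.Adj w v → u ≠ v → c u = c v → c u < 2) :
    SColorable G ![1, 1, 2, 2] := by
  refine ⟨fun v => ⟨c v, hc v⟩, fun j u hu v hv hne => ?_⟩
  simp only [Set.mem_ofPred_eq, Fin.ext_iff] at hu hv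
  have hnadj : ¬ G.Adj u v := fun h => hadj u v h (hu.trans hv.symm)
  have hfar : 2 ≤ c u → ((2 : ℕ) : ℕ∞) < G.edist u v := fun h2 =>
    two_lt_edist hne hnadj fun w h1 h3 => by
      have := htwo u w v h1 h3 hne (hu.trans hv.symm)
      omega
  fin_cases j
  · exact one_lt_edist hne hnadj
  · exact one_lt_edist hne hnadj
  · exact hfar (by simp at hu; omega)
  · exact hfar (by simp at hu; omega)

/-- Two steps through a subdivision vertex either traverse an edge of `G` or return to their start;
`m` only drives the induction. -/
theorem exists_walk_of_subdivision_walk : ∀ (m : ℕ) {u v : V}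
    (p : (subdivision G).Walk (Sum.inl u) (Sum.inl v)), p.length ≤ m →
      ∃ q : G.Walk u v, 2 * q.length ≤ p.length
  | m, u, _, .nil, _ => ⟨.nil, by simp⟩
  | m, u, v, .cons (v := .inl w) h1 p, _ => by
    simp [subdivision] at h1
  | m, u, v, .cons (v := .inr e) h1 (.cons (v := .inr e') h2 p), _ => by
    simp [subdivision] at h2
  | 0, u, v, .cons (v := .inr e) h1 (.cons (v := .inl w) h2 p), hp => by simp at hp
  | m + 1, u, v, .cons (v := .inr e) h1 (.cons (v := .inl w) h2 p), hp => by
    obtain ⟨q, hq⟩ := exists_walk_of_subdivision_walk m p (by simp at hp; omega)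
    have hu : u ∈ (e : Sym2 V) := by simpa [subdivision] using h1
    have hw : w ∈ (e : Sym2 V) := by simpa [subdivision] using h2
    by_cases huw : u = w
    · subst huw
      exact ⟨q, by simp; omega⟩
    · have he : (e : Sym2 V) = s(u, w) := (Sym2.mem_and_mem_iff huw).1 ⟨hu, hw⟩
      have hadj : G.Adj u w := by
        rw [← SimpleGraph.mem_edgeSet, ← he]
        exact e.2
      exact ⟨.cons hadj q, by simp; omega⟩

theorem lt_edist_subdivision {u v : V} {i : ℕ} (h : (i : ℕ∞) < G.edist u v) :
    ((2 * i + 1 : ℕ) : ℕ∞) < (subdivision G).edist (Sum.inl u) (Sum.inl v) := by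
  by_contra hle
  obtain ⟨p, hp⟩ := exists_walk_of_edist_le (not_lt.mp hle)
  obtain ⟨q, hq⟩ := exists_walk_of_subdivision_walk _ p le_rfl
  have h1 : (i : ℕ∞) < q.length := h.trans_le q.edist_le
  have h2 : i < q.length := by exact_mod_cast h1
  omega

theorem packingColorable_subdivision (h : SColorable G ![1, 1, 2, 2]) :
    PackingColorable (subdivision G) 5 := by
  obtain ⟨c, hc⟩ := h
  refine ⟨Sum.elim (fun v => (c v).succ) (fun _ => 0), fun j => ?_⟩
  rintro (u | e) hu (v | e') hv hne
  · simp only [Set.mem_ofPred_eq, Sum.elim_inl] at hu hv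
    subst hu
    have hcv : c v = c u := by simpa using hv
    have hlt := lt_edist_subdivision (hc (c u) (u := u) rfl (v := v) hcv (by simpa using hne))
    refine lt_of_le_of_lt ?_ hlt
    -- The classes must be 2-, 3-, 4-, 5-packings and are known to be 3-, 3-, 5-, 5-packings.
    have key : ∀ a : Fin 4, (a.succ : ℕ) + 1 ≤ 2 * (![1, 1, 2, 2] : Fin 4 → ℕ) a + 1 := by
      decide
    exact_mod_cast key (c u)
  · simp only [Set.mem_ofPred_eq, Sum.elim_inl, Sum.elim_inr] at hu hv
    exact absurd (hu.trans hv.symm) (Fin.succ_ne_zero _)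
  · simp only [Set.mem_ofPred_eq, Sum.elim_inl, Sum.elim_inr] at hu hv
    exact absurd (hv.trans hu.symm) (Fin.succ_ne_zero _)
  · simp only [Set.mem_ofPred_eq, Sum.elim_inr] at hu
    subst hu
    simpa using one_lt_edist (G := subdivision G) hne (by simp [subdivision])

theorem packingChromaticNumber_subdivision_le (h : SColorable G ![1, 1, 2, 2]) :
    packingChromaticNumber (subdivision G) ≤ 5 :=
  iInf₂_le (5 : ℕ) (packingColorable_subdivision h)

end General

/-! ### Adjacency and distance two in `P(n, k)` -/

section Petersen

variable {n k : ℕ}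

theorem generalizedPetersen_adj_inl_inl {x y : ZMod n}
    (h : (generalizedPetersen n k).Adj (Sum.inl x) (Sum.inl y)) : y = x + 1 ∨ x = y + 1 := by
  simp only [generalizedPetersen, SimpleGraph.fromEdgeSet_adj, Set.mem_union, Set.mem_ofPred_eq,
    Sym2.eq_iff] at h
  obtain ⟨((⟨i, h⟩ | ⟨i, h⟩) | ⟨i, h⟩), -⟩ := h <;> simp at h
  rcases h with ⟨rfl, rfl⟩ | ⟨rfl, rfl⟩ <;> simp

theorem generalizedPetersen_adj_inl_inr {x y : ZMod n}
    (h : (generalizedPetersen n k).Adj (Sum.inl x) (Sum.inr y)) : x = y := by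
  simp only [generalizedPetersen, SimpleGraph.fromEdgeSet_adj, Set.mem_union, Set.mem_ofPred_eq,
    Sym2.eq_iff] at h
  obtain ⟨((⟨i, h⟩ | ⟨i, h⟩) | ⟨i, h⟩), -⟩ := h <;> simp at h
  rcases h with ⟨rfl, rfl⟩
  rfl

theorem generalizedPetersen_adj_inr_inr {x y : ZMod n}
    (h : (generalizedPetersen n k).Adj (Sum.inr x) (Sum.inr y)) : y = x + k ∨ x = y + k := by
  simp only [generalizedPetersen, SimpleGraph.fromEdgeSet_adj, Set.mem_union, Set.mem_ofPred_eq,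
    Sym2.eq_iff] at h
  obtain ⟨((⟨i, h⟩ | ⟨i, h⟩) | ⟨i, h⟩), -⟩ := h <;> simp at h
  rcases h with ⟨rfl, rfl⟩ | ⟨rfl, rfl⟩ <;> simp

/-- Apart from two steps along one rim, distance two only joins `u_x` to `v_{x±1}` and `v_{x±k}`. -/
theorem sColorable_generalizedPetersen (a b : ZMod n → ℕ) (ha : ∀ x, a x < 4)
    (hb : ∀ x, b x < 4) (ha1 : ∀ x, a x ≠ a (x + 1)) (hab : ∀ x, a x ≠ b x)
    (hb1 : ∀ x, b x ≠ b (x + k))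
    (ha2 : ∀ x, x ≠ x + 1 + 1 → a x = a (x + 1 + 1) → a x < 2)
    (hb2 : ∀ x, b x = b (x + k + k) → b x < 2)
    (hab1 : ∀ x, a x = b (x + 1) → a x < 2) (hba1 : ∀ x, b x = a (x + 1) → b x < 2)
    (habk : ∀ x, a x = b (x + k) → a x < 2) (hbak : ∀ x, b x = a (x + k) → b x < 2) :
    SColorable (generalizedPetersen n k) ![1, 1, 2, 2] := by
  have hmix : ∀ (x y : ZMod n) w, (generalizedPetersen n k).Adj (Sum.inl x) w →
      (generalizedPetersen n k).Adj w (Sum.inr y) → a x = b y → a x < 2 := by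
    rintro x y (w | w) h1 h2 hxy
    · obtain rfl := generalizedPetersen_adj_inl_inr h2
      rcases generalizedPetersen_adj_inl_inl h1 with rfl | rfl
      · exact hab1 _ hxy
      · rw [hxy]
        exact hba1 _ hxy.symm
    · obtain rfl := generalizedPetersen_adj_inl_inr h1
      rcases generalizedPetersen_adj_inr_inr h2 with rfl | rfl
      · exact habk _ hxy
      · rw [hxy]
        exact hbak _ hxy.symm
  refine sColorable_of_coloring (Sum.elim a b) ?_ ?_ ?_
  · rintro (x | x)
    exacts [ha x, hb x]
  · rintro (x | x) (y | y) h
    · rcases generalizedPetersen_adj_inl_inl h with rfl | rfl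
      exacts [ha1 _, (ha1 _).symm]
    · obtain rfl := generalizedPetersen_adj_inl_inr h
      exact hab _
    · obtain rfl := generalizedPetersen_adj_inl_inr h.symm
      exact (hab _).symm
    · rcases generalizedPetersen_adj_inr_inr h with rfl | rfl
      exacts [hb1 _, (hb1 _).symm]
  · rintro (x | x) w (y | y) h1 h2 hne hxy
    · rcases w with w | w
      · rcases generalizedPetersen_adj_inl_inl h1 with rfl | rfl <;>
          rcases generalizedPetersen_adj_inl_inl h2 with rfl | h
        · exact ha2 _ (by simpa using hne) hxy
        · exact absurd (by rw [add_right_cancel h]) hne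
        · exact absurd rfl hne
        · subst h
          simp only [Sum.elim_inl] at hxy ⊢
          rw [hxy]
          exact ha2 _ (by simpa using hne.symm) hxy.symm
      · obtain rfl := generalizedPetersen_adj_inl_inr h1
        obtain rfl := generalizedPetersen_adj_inl_inr h2.symm
        exact absurd rfl hne
    · exact hmix x y w h1 h2 hxy
    · simp only [Sum.elim_inl, Sum.elim_inr] at hxy ⊢
      rw [hxy]
      exact hmix y x w h2.symm h1.symm hxy.symm
    · rcases w with w | w
      · obtain rfl := generalizedPetersen_adj_inl_inr h1.symm
        obtain rfl := generalizedPetersen_adj_inl_inr h2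
        exact absurd rfl hne
      · rcases generalizedPetersen_adj_inr_inr h1 with rfl | rfl <;>
          rcases generalizedPetersen_adj_inr_inr h2 with rfl | h
        · exact hb2 _ hxy
        · exact absurd (by rw [add_right_cancel h]) hne
        · exact absurd rfl hne
        · subst h
          simp only [Sum.elim_inr] at hxy ⊢
          rw [hxy]
          exact hb2 _ hxy.symm

/-! ### Even `n`: colouring the inner cycles -/

/-- A colouring of a cycle of length `d ≠ 1, 2, 5` in which `2` and `3` do not repeat at distance at
most two and `0` does not repeat at distance one. -/
def cyclePattern (d p : ℕ) : ℕ :=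
  if p + 4 * (d % 3) < d then (if p % 3 = 0 then 0 else if p % 3 = 1 then 2 else 3)
  else if (p + 4 * (d % 3) - d) % 4 = 1 then 2
  else if (p + 4 * (d % 3) - d) % 4 = 3 then 3 else 0

theorem cyclePattern_cases (d p : ℕ) :
    cyclePattern d p = 0 ∨ cyclePattern d p = 2 ∨ cyclePattern d p = 3 := by
  unfold cyclePattern
  split_ifs <;> simp

/-- The pattern is triples `0,2,3` followed by `d % 3` blocks `0,2,0,3`. These fit when `4 * (d % 3)
≤ d`, which for `d ≥ 3` fails only at `d = 5`. -/
theorem cyclePattern_succ_ne {d p q : ℕ} (hd : 3 ≤ d) (hd5 : d ≠ 5) (hp : p < d)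
    (hq : q = p + 1 ∧ q < d ∨ q + d = p + 1) : cyclePattern d p ≠ cyclePattern d q := by
  unfold cyclePattern
  split_ifs <;> omega

theorem cyclePattern_add_two {d p q : ℕ} (hd : 3 ≤ d) (hp : p < d)
    (hq : q = p + 2 ∧ q < d ∨ q + d = p + 2) (h : cyclePattern d p = cyclePattern d q) :
    cyclePattern d p = 0 := by
  unfold cyclePattern at *
  split_ifs at * <;> omega

/-- Position of `x` on its `g`-cycle: the multiple of `g` separating `x` from a chosen
representative of its coset. -/
theorem exists_index_addOrderOf {A : Type*} [AddCommGroup A] (g : A) :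
    ∃ f : A → ZMod (addOrderOf g), ∀ x, f (x + g) = f x + 1 := by
  have hmem : ∀ x : A, ∃ m : ℤ,
      m • g = -(Quotient.out (x : A ⧸ AddSubgroup.zmultiples g)) + x := fun x =>
    AddSubgroup.mem_zmultiples_iff.1 (QuotientAddGroup.eq.1 (QuotientAddGroup.out_eq' _))
  choose m hm using hmem
  refine ⟨fun x => m x, fun x => ?_⟩
  have hq : ((x + g : A) : A ⧸ AddSubgroup.zmultiples g) = x :=
    QuotientAddGroup.mk_add_of_mem x (AddSubgroup.mem_zmultiples g)
  have h1 := hm (x + g)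
  rw [hq, ← add_assoc, ← hm x] at h1
  have h2 : (m (x + g) - (m x + 1)) • g = 0 := by
    rw [sub_smul, h1, add_smul, one_smul, sub_self]
  have h3 := (ZMod.intCast_zmod_eq_zero_iff_dvd _ _).2
    (addOrderOf_dvd_iff_zsmul_eq_zero.2 h2)
  push_cast at h3
  exact sub_eq_zero.1 h3

theorem zmod_val_add_natCast {m : ℕ} (hm : m < n) (x : ZMod n) :
    (x + m).val = if x.val + m < n then x.val + m else x.val + m - n := by
  have : NeZero n := ⟨by omega⟩
  have hx := ZMod.val_lt x
  rw [ZMod.val_add, ZMod.val_natCast_of_lt hm]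
  split_ifs with h
  · exact Nat.mod_eq_of_lt h
  · rw [Nat.mod_eq_sub_mod (by omega), Nat.mod_eq_of_lt (by omega)]

theorem zmod_val_add_one (hn : 1 < n) (x : ZMod n) :
    (x + 1).val = if x.val + 1 < n then x.val + 1 else x.val + 1 - n := by
  simpa using zmod_val_add_natCast hn x

theorem sColorable_generalizedPetersen_of_even (hk : 0 < k) (hkn : 2 * k < n) (h5 : ¬ 5 ∣ n)
    (hn : 2 ∣ n) : SColorable (generalizedPetersen n k) ![1, 1, 2, 2] := by
  have : NeZero n := ⟨by omega⟩
  obtain ⟨d, hd⟩ : ∃ d, d = addOrderOf (k : ZMod n) := ⟨_, rfl⟩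
  obtain ⟨f, hf⟩ : ∃ f : ZMod n → ZMod d, ∀ x, f (x + k) = f x + 1 :=
    hd ▸ exists_index_addOrderOf (k : ZMod n)
  have hdn : d ∣ n := hd ▸ addOrderOf_dvd_iff_nsmul_eq_zero.2 (by simp)
  have hd5 : d ≠ 5 := fun h => h5 (h ▸ hdn)
  have hd3 : 3 ≤ d := by
    -- A positive multiple `d * k` of `n` exceeds `2 * k`, so `d > 2`.
    have h0 : d * k = 0 ∨ n ≤ d * k := by
      have : n ∣ d * k := by
        rw [← ZMod.natCast_eq_zero_iff, Nat.cast_mul, ← nsmul_eq_mul]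
        exact hd ▸ addOrderOf_nsmul_eq_zero _
      rcases Nat.eq_zero_or_pos (d * k) with h | h
      exacts [Or.inl h, Or.inr (Nat.le_of_dvd h this)]
    have hpos : 0 < d := Nat.pos_of_dvd_of_pos hdn (by omega)
    by_contra hlt
    have : d * k ≤ 2 * k := Nat.mul_le_mul_right k (by omega)
    have : 0 < d * k := Nat.mul_pos hpos hk
    omega
  have : NeZero d := ⟨by omega⟩
  have hlt : ∀ x, (f x).val < d := fun x => ZMod.val_lt _
  have hval : ∀ x, (f (x + k)).val = if (f x).val + 1 < d then (f x).val + 1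
      else (f x).val + 1 - d := fun x => by
    rw [hf]
    exact zmod_val_add_one (by omega) _
  have hone := fun x : ZMod n => zmod_val_add_one (by omega) x
  have hxn : ∀ x : ZMod n, x.val < n := fun x => ZMod.val_lt _
  -- A `0` of the pattern stands for the parity colour unused by the outer neighbour.
  refine sColorable_generalizedPetersen (fun x => x.val % 2)
    (fun x => if cyclePattern d (f x).val = 0 then (x.val + 1) % 2 else cyclePattern d (f x).val)
    ?_ ?_ ?_ ?_ ?_ ?_ ?_ ?_ ?_ ?_ ?_ <;> intro x
  · omega
  · have := cyclePattern_cases d (f x).val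
    split_ifs <;> omega
  · have := hone x
    have := hxn x
    split_ifs at * <;> omega
  · have := cyclePattern_cases d (f x).val
    split_ifs <;> omega
  · have h1 := cyclePattern_cases d (f x).val
    have h2 := cyclePattern_cases d (f (x + k)).val
    have h3 := cyclePattern_succ_ne hd3 hd5 (hlt x) (q := (f (x + k)).val) (by
      have := hval x
      have := hlt x
      split_ifs at * <;> omega)
    split_ifs <;> omega
  · omega
  · have h1 := cyclePattern_cases d (f x).val
    have h2 := cyclePattern_cases d (f (x + k + k)).val
    have h3 := cyclePattern_add_two hd3 (hlt x) (q := (f (x + k + k)).val) (by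
      have := hval x
      have := hval (x + k)
      have := hlt x
      split_ifs at * <;> omega)
    split_ifs <;> omega
  all_goals
    intro h
    omega

/-! ### Odd `n`: explicit colourings -/

/-- A criterion for odd `n`: the outer vertices are coloured by parity, except that `u₀` has
colour `2`. -/
theorem sColorable_generalizedPetersen_of_odd (hk : 0 < k) (hkn : 2 * k < n) (hn : n % 2 = 1)
    (b : ℕ → ℕ) (hb : ∀ i < n, b i = (i + 1) % 2 ∨ b i = 2 ∨ b i = 3)
    (hX : ∀ i < n, b i = 2 → i ≠ 0 ∧ i ≠ 1 ∧ i ≠ n - 1 ∧ i ≠ k ∧ i ≠ n - k)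
    (hb1 : ∀ i j, i < n → j < n → (j = i + k ∨ j + n = i + k) → b i ≠ b j)
    (hb2 : ∀ i j, i < n → j < n → (j = i + 2 * k ∨ j + n = i + 2 * k) → b i = b j → b i < 2) :
    SColorable (generalizedPetersen n k) ![1, 1, 2, 2] := by
  have : NeZero n := ⟨by omega⟩
  have hone := fun x : ZMod n => zmod_val_add_one (by omega) x
  have hadd := fun x : ZMod n => zmod_val_add_natCast (m := k) (by omega) x
  have hxn : ∀ x : ZMod n, x.val < n := fun x => ZMod.val_lt _
  have hbx := fun x : ZMod n => hb x.val (hxn x)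
  have hXx := fun x : ZMod n => hX x.val (hxn x)
  -- `hX` keeps colour `2` off the inner vertices within distance two of `u₀`.
  refine sColorable_generalizedPetersen (fun x => if x.val = 0 then 2 else x.val % 2)
    (fun x => b x.val) ?_ ?_ ?_ ?_ ?_ ?_ ?_ ?_ ?_ ?_ ?_ <;> intro x
  · split_ifs <;> omega
  · have := hbx x
    omega
  · have := hone x
    have := hxn x
    split_ifs at * <;> omega
  · have := hbx x
    have := hXx x
    split_ifs at * <;> omega
  · have := hadd x
    have := hxn x
    exact hb1 _ _ (hxn _) (hxn _) (by split_ifs at * <;> omega)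
  · intro hne
    have h1 := hone x
    have h2 := hone (x + 1)
    have := hxn x
    have hne' : x.val ≠ (x + 1 + 1).val := fun h => hne (ZMod.val_injective n h)
    split_ifs at * <;> omega
  · have h1 := hadd x
    have h2 := hadd (x + k)
    have := hxn x
    exact hb2 _ _ (hxn _) (hxn _) (by split_ifs at * <;> omega)
  · have h1 := hone x
    have := hXx (x + 1)
    have := hxn x
    split_ifs at * <;> omega
  · have h1 := hone x
    have := hXx x
    have := hbx x
    have := hxn x
    split_ifs at * <;> omega
  · have h1 := hadd x
    have := hXx (x + k)
    have := hxn x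
    split_ifs at * <;> omega
  · have h1 := hadd x
    have := hXx x
    have := hbx x
    have := hxn x
    split_ifs at * <;> omega

/-- For odd `k` the default colours clash only across wrapping edges, which start in the last `k`
indices. Two steps from there land below `2 * k ≤ n - k`. -/
theorem sColorable_generalizedPetersen_of_odd_of_three_mul_le_of_odd (hk : 0 < k)
    (hkn : 3 * k ≤ n) (hn : n % 2 = 1) (hk2 : k % 2 = 1) :
    SColorable (generalizedPetersen n k) ![1, 1, 2, 2] := by
  refine sColorable_generalizedPetersen_of_odd hk (by omega) hn
    (fun i => if n ≤ i + k then 3 else (i + 1) % 2) ?_ ?_ ?_ ?_ <;> intros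
  all_goals split_ifs at * <;> omega

theorem sColorable_generalizedPetersen_of_odd_of_three_mul_le_of_even (hk : 0 < k)
    (hkn : 3 * k ≤ n) (hn : n % 2 = 1) (hk2 : k % 2 = 0) :
    SColorable (generalizedPetersen n k) ![1, 1, 2, 2] := by
  have h0 : ∀ i, i < k → i / k = 0 := fun i hi => Nat.div_eq_of_lt hi
  have h1 : ∀ i, (i + k) / k = i / k + 1 := fun i => Nat.add_div_right i hk
  -- For even `k` a step without wrapping preserves parity, a wrapping one flips it. Each chain `i,
  -- i + k, …` from `i < k` up to the wrap reads default, `3`, default, `2`, …; it ends in a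
  -- default, and the entry before that is made `2` or `3`.
  refine sColorable_generalizedPetersen_of_odd hk (by omega) hn
    (fun i => if n ≤ i + k then (i + 1) % 2 else if i / k % 4 = 1 then 3 else
      if i / k % 4 = 3 then 2 else if i + 2 * k < n then (i + 1) % 2 else
      if i / k % 4 = 0 then 3 else 2) ?_ ?_ ?_ ?_
  · intro i hi
    split_ifs <;> omega
  · intro i hi
    have := h0 i
    by_cases hik : i = k
    · have := Nat.div_self hk
      subst hik
      split_ifs <;> omega
    · split_ifs <;> omega
  · rintro i j hi hj (rfl | hij)
    · have := h0 i
      have := h1 i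
      split_ifs <;> omega
    · have := h0 i
      have := h0 j
      split_ifs <;> omega
  · rintro i j hi hj (rfl | hij)
    · have := h0 i
      have := h1 i
      have := h1 (i + k)
      rw [show i + k + k = i + 2 * k by omega] at this
      split_ifs <;> omega
    · by_cases hik : n ≤ i + k
      · have := h0 (j - k)
        have h2 := h1 (j - k)
        by_cases hjk : k ≤ j
        · rw [Nat.sub_add_cancel hjk] at h2
          split_ifs <;> omega
        · omega
      · have := h0 j
        split_ifs <;> omega

theorem sColorable_generalizedPetersen_of_odd_of_lt_three_mul_of_odd (hkn : 2 * k < n)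
    (hkn3 : n < 3 * k) (hn : n % 2 = 1) (hk2 : k % 2 = 1) :
    SColorable (generalizedPetersen n k) ![1, 1, 2, 2] := by
  obtain ⟨s, rfl⟩ : ∃ s, n = 2 * k + s := ⟨n - 2 * k, by omega⟩
  have hs : 0 < s := by omega
  obtain ⟨P, hP2, hPs, hP0, hPk⟩ : ∃ P : ℕ → ℕ, (∀ y, P y = 2 ∨ P y = 3) ∧
      (∀ y, P (y + s) ≠ P y) ∧ P 0 = 3 ∧ P (k - 1) = 3 := by
    -- Modulo `n`, `2 * k` is `-s`, so `P` must alternate under shifts by `s`. The residue class of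
    -- `k - 1` is rephased to give `P (k - 1) = 3`; if it contains `0`, `P 0 = 3` survives since `s`
    -- is odd and `k - 1` even.
    refine ⟨fun y => if (y / s + if y % s = (k - 1) % s then (k - 1) / s else 0) % 2 = 0 then 3
      else 2, fun y => ?_, fun y => ?_, ?_, ?_⟩ <;> dsimp only
    · split_ifs <;> simp
    · rw [Nat.add_div_right y hs, Nat.add_mod_right]
      split_ifs <;> omega
    · have : (k - 1) % s = 0 → (k - 1) / s % 2 = 0 := fun h => by
        have h1 := Nat.div_mul_cancel (Nat.dvd_of_mod_eq_zero h)
        have h2 : (k - 1) / s * s % 2 = 0 := by omega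
        rw [Nat.mul_mod, show s % 2 = 1 by omega] at h2
        omega
      rw [Nat.zero_div, Nat.zero_mod]
      split_ifs <;> omega
    · split_ifs <;> omega
  refine sColorable_generalizedPetersen_of_odd (by omega) hkn hn
    (fun i => if k + s ≤ i then P (i - (k + s)) else (i + 1) % 2) ?_ ?_ ?_ ?_
  · intro i hi
    have := hP2 (i - (k + s))
    split_ifs <;> omega
  · intro i hi
    by_cases h1 : i = 2 * k + s - 1
    · rw [show i - (k + s) = k - 1 by omega, hPk]
      split_ifs <;> omega
    · by_cases h2 : i = k + s
      · rw [show i - (k + s) = 0 by omega, hP0]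
        split_ifs <;> omega
      · split_ifs <;> omega
  · intro i j hi hj hij
    have := hP2 (i - (k + s))
    have := hP2 (j - (k + s))
    split_ifs <;> omega
  · intro i j hi hj hij
    have h1 := hP2 (i - (k + s))
    have h2 := hPs (j - (k + s))
    by_cases h : j + s = i
    · split_ifs
      · rw [show j - (k + s) + s = i - (k + s) by omega] at h2
        omega
      all_goals omega
    · split_ifs <;> omega

theorem sColorable_generalizedPetersen_of_odd_of_lt_three_mul_of_even (hkn : 2 * k < n)
    (hkn3 : n < 3 * k) (hn : n % 2 = 1) (hk2 : k % 2 = 0) (h5 : 5 * k ≠ 2 * n) :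
    SColorable (generalizedPetersen n k) ![1, 1, 2, 2] := by
  obtain ⟨s, rfl⟩ : ∃ s, n = 2 * k + s := ⟨n - 2 * k, by omega⟩
  have hs : 0 < s := by omega
  obtain ⟨P, hP2, hPs, hP0⟩ : ∃ P : ℕ → ℕ, (∀ y, P y = 2 ∨ P y = 3) ∧
      (∀ y, P (y + s) ≠ P y) ∧ ∀ y < s, P y = 2 := by
    refine ⟨fun y => if y / s % 2 = 0 then 2 else 3, fun y => ?_, fun y => ?_, fun y hy => ?_⟩ <;>
      dsimp only
    · split_ifs <;> simp
    · rw [Nat.add_div_right y hs]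
      split_ifs <;> omega
    · simp [Nat.div_eq_of_lt hy]
  -- `v_k` may not have colour `2`, so it gets `3`; then `v_{k+s}`, two steps away, falls back to
  -- its default, which forces a `3` on its neighbour `v_s`. The two new `3`s are two steps apart
  -- only if `k = 2 * s`, which `h5` excludes.
  refine sColorable_generalizedPetersen_of_odd (by omega) hkn hn
    (fun i => if i = s ∨ i = k then 3 else if k < i ∧ i < 2 * k ∧ i ≠ k + s then P (i - k)
      else (i + 1) % 2) ?_ ?_ ?_ ?_
  · intro i hi
    have := hP2 (i - k)
    split_ifs <;> omega
  · intro i hi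
    split_ifs <;> omega
  · intro i j hi hj hij
    have h1 := hP2 (i - k)
    have h2 := hP2 (j - k)
    by_cases h : i = k + 2 * s
    · have h3 := hPs s
      have h4 := hPs 0
      have h5 := hP0 0 hs
      rw [show s + s = i - k by omega] at h3
      rw [Nat.zero_add] at h4
      have h6 := hP2 s
      split_ifs <;> omega
    · split_ifs <;> omega
  · intro i j hi hj hij
    have h1 := hP2 (i - k)
    have h2 := hP2 (j - k)
    have h3 := hPs (j - k)
    have h4 := hP0 (i - k)
    by_cases h : j + s = i ∧ k ≤ j
    · rw [show j - k + s = i - k by omega] at h3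
      split_ifs <;> omega
    · split_ifs <;> omega

end Petersen

end PackingColoring

theorem corollary4p2 (n k : ℕ) (hk : 0 < k) (hkn : 2 * k < n) (h5 : ¬ 5 ∣ n) :
    PackingColoring.SColorable (PackingColoring.generalizedPetersen n k) ![1, 1, 2, 2] ∧
      PackingColoring.packingChromaticNumber
        (PackingColoring.subdivision (PackingColoring.generalizedPetersen n k)) ≤ 5 := by
  have key : PackingColoring.SColorable (PackingColoring.generalizedPetersen n k)
      ![1, 1, 2, 2] := by
    by_cases hn : n % 2 = 0
    · exact PackingColoring.sColorable_generalizedPetersen_of_even hk hkn h5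
        (Nat.dvd_of_mod_eq_zero hn)
    by_cases h3 : 3 * k ≤ n <;> by_cases hk2 : k % 2 = 0
    · exact PackingColoring.sColorable_generalizedPetersen_of_odd_of_three_mul_le_of_even hk h3
        (by omega) hk2
    · exact PackingColoring.sColorable_generalizedPetersen_of_odd_of_three_mul_le_of_odd hk h3
        (by omega) (by omega)
    · exact PackingColoring.sColorable_generalizedPetersen_of_odd_of_lt_three_mul_of_even hkn
        (by omega) (by omega) hk2 (by omega)
    · exact PackingColoring.sColorable_generalizedPetersen_of_odd_of_lt_three_mul_of_odd hkn
        (by omega) (by omega) (by omega)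
  exact ⟨key, PackingColoring.packingChromaticNumber_subdivision_le key⟩
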